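/- Let $\mu$ be a measure on a measurable space, $d\ge 1$, and let $(p_\beta)_{\beta\in\Theta}$, $\Theta\subseteq\mathbb R^d$, be a family of non-negative functions (a possibly unnormalized model). Let $\beta^*$ be an interior point of $\Theta$ such that $p_d:=p_{\beta^*}$ is a probability density with respect to $\mu$ and $\beta\mapsto p_\beta(x)$ is differentiable at $\beta^*$ for $\mu$-almost every $x$. Let $s(x)=\nabla_\beta\log p_\beta(x)|_{\beta=\beta^*}$ be the score, assumed square-integrable under $p_d$, and put $m=\mathbb E_{p_d}[s]$ and $I=\mathbb E_{p_d}[ss^\top]$, with $I$ assumed invertible. For a noise density $p_n\ge 0$, a noise-data ratio $\nu=T_n/T_d>0$ and a budget $T=T_d+T_n>0$, put $r=p_d/(\nu p_n)$, $P(Y=0\mid x)=\frac{\nu p_n(x)}{p_d(x)+\nu p_n(x)}$ and, with $\phi(t)=t\log t-(1+t)\log\frac{1+t}{2}$ (logistic loss), $w=r\,\phi''(r)$ and $v=w^2/P(Y=0\mid\cdot)$. For a weight $u$ write $m_u=\mathbb E_{p_d}[u\,s]$ and $I_u=\mathbb E_{p_d}[u\,ss^\top]$. The (asymptotic) mean-squared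 error of noise-contrastive estimation (NCE) is $$\mathrm{MSE}_{\mathrm{NCE}}(T,\nu,p_n)=\frac{1}{T_d}\,\mathrm{tr}(\Sigma)=\frac{\nu+1}{T}\,\mathrm{tr}(\Sigma),\qquad \Sigma=I_w^{-1}\Big(I_v-\big(1+\tfrac1\nu\big)m_wm_w^\top\Big)I_w^{-1}$$ (by convention, the inverse of a singular matrix is $0$, an integral that does not exist is $0$, and $w=v=0$ where $p_n=0$). Then: 1. For every $p_n\ge 0$ and all $\nu,T>0$, $\mathrm{MSE}_{\mathrm{NCE}}(T,\nu,p_n)=\frac{\nu+1}{T}\,\mathrm{tr}\big(I_w^{-1}-\frac{\nu+1}{\nu}I_w^{-1}m_wm_w^\top I_w^{-1}\big)$, where $w$ may be taken to be $P(Y=0\mid\cdot)$. Suppose now that $p_n=p_d$ ($\mu$-almost everywhere). 2. For all $\nu,T>0$, $\mathrm{MSE}_{\mathrm{NCE}}(T,\nu,p_n)=\frac{(\nu+1)^2}{\nu T}\,\mathrm{tr}\big(I^{-1}-I^{-1}mm^\top I^{-1}\big)$. 3. For every fixed $T>0$, the function $\nu\mapsto\mathrm{MSE}_{\mathrm{NCE}}(T,\nu,p_n)$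 on $(0,\infty)$ attains its minimum at $\nu=1$, i.e. at a noise proportion $T_n/T=\nu/(\nu+1)$ of $1/2$. If $\mathrm{tr}(I^{-1}-I^{-1}mm^\top I^{-1})\neq0$, then $\nu=1$ is the only minimizer. 4. Suppose moreover that the model is normalized, i.e. $\int p_\beta\,d\mu=1$ for all $\beta\in\Theta$, and that there are $\rho>0$ and a $\mu$-integrable $g$ such that, for $\mu$-almost every $x$, $|p_\beta(x)-p_{\beta^*}(x)|\le g(x)\|\beta-\beta^*\|$ whenever $\|\beta-\beta^*\|<\rho$. Let $\mathrm{MSE}_{\mathrm{MLE}}(T_d)=\frac1{T_d}\mathrm{tr}(I^{-1})$ be the (asymptotic) mean-squared error of maximum-likelihood estimation from $T_d=T/(\nu+1)$ data points, where $I$ is now the Fisher information matrix. Then for all $\nu,T>0$, $$\frac{\mathrm{MSE}_{\mathrm{NCE}}(T,\nu,p_n)}{\mathrm{MSE}_{\mathrm{MLE}}(T_d)}=1+\frac1\nu .$$ -/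

import Mathlib

open MeasureTheory Filter Topology Set
open scoped Matrix

noncomputable section

namespace NCE

variable {X : Type*} [MeasurableSpace X] {d : ℕ}

/-- The (generalized Fisher) score `x ↦ ∇_β log p_β(x)` of a possibly unnormalized parametric
model `p`, taken at the parameter `β`. -/
def score (p : EuclideanSpace ℝ (Fin d) → X → ℝ) (β : EuclideanSpace ℝ (Fin d)) (x : X) :
    EuclideanSpace ℝ (Fin d) :=
  gradient (fun b => Real.log (p b x)) β

/-- The distribution with density `f` with respect to the base measure `μ`. -/
def densityMeasure (μ : Measure X) (f : X → ℝ) : Measure X :=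
  μ.withDensity (fun x => ENNReal.ofReal (f x))

/-- Reweighted score mean `𝔼_{x ∼ p_d} [w(x) s(x)]`, where `p_d = p_β` and `s` is the score
at `β`. -/
def weightedMean (μ : Measure X) (p : EuclideanSpace ℝ (Fin d) → X → ℝ)
    (β : EuclideanSpace ℝ (Fin d)) (w : X → ℝ) : Fin d → ℝ :=
  fun i => ∫ x, w x * score p β x i ∂(densityMeasure μ (p β))

/-- Reweighted score covariance `𝔼_{x ∼ p_d} [w(x) s(x) s(x)ᵀ]`, where `p_d = p_β` and `s` is the
score at `β`. -/
def weightedCov (μ : Measure X) (p : EuclideanSpace ℝ (Fin d) → X → ℝ)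
    (β : EuclideanSpace ℝ (Fin d)) (w : X → ℝ) : Matrix (Fin d) (Fin d) ℝ :=
  Matrix.of fun i j =>
    ∫ x, w x * (score p β x i * score p β x j) ∂(densityMeasure μ (p β))

/-- Unweighted score mean `m = 𝔼_{x ∼ p_d} [s(x)]`. -/
def scoreMean (μ : Measure X) (p : EuclideanSpace ℝ (Fin d) → X → ℝ)
    (β : EuclideanSpace ℝ (Fin d)) : Fin d → ℝ :=
  fun i => ∫ x, score p β x i ∂(densityMeasure μ (p β))

/-- Unweighted score covariance `I = 𝔼_{x ∼ p_d} [s(x) s(x)ᵀ]`; for a normalized model this is the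
Fisher information matrix. -/
def scoreCov (μ : Measure X) (p : EuclideanSpace ℝ (Fin d) → X → ℝ)
    (β : EuclideanSpace ℝ (Fin d)) : Matrix (Fin d) (Fin d) ℝ :=
  Matrix.of fun i j => ∫ x, score p β x i * score p β x j ∂(densityMeasure μ (p β))

/-- Posterior probability `P(Y = 0 | x) = ν p_n / (p_d + ν p_n)` that `x` is a noise point. -/
def noisePosterior (ν : ℝ) (pd pn : X → ℝ) (x : X) : ℝ :=
  ν * pn x / (pd x + ν * pn x)

/-- Bregman reweighting `w(x) = r φ''(r)` with the density ratio `r = p_d(x) / (ν p_n(x))`. -/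
def bregmanWeight (φ : ℝ → ℝ) (ν : ℝ) (pd pn : X → ℝ) (x : X) : ℝ :=
  pd x / (ν * pn x) * deriv (deriv φ) (pd x / (ν * pn x))

/-- The second reweighting `v(x) = w(x)² P(Y = 0 | x)⁻¹`. -/
def bregmanWeightV (φ : ℝ → ℝ) (ν : ℝ) (pd pn : X → ℝ) (x : X) : ℝ :=
  bregmanWeight φ ν pd pn x ^ 2 * (noisePosterior ν pd pn x)⁻¹

/-- Asymptotic variance matrix of the estimator obtained from the Bregman classification loss `φ`,
`Σ = I_w⁻¹ (I_v - (1 + 1/ν) m_w m_wᵀ) I_w⁻¹`. -/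
def asympVar (μ : Measure X) (p : EuclideanSpace ℝ (Fin d) → X → ℝ)
    (β : EuclideanSpace ℝ (Fin d)) (φ : ℝ → ℝ) (pn : X → ℝ) (ν : ℝ) :
    Matrix (Fin d) (Fin d) ℝ :=
  let w := bregmanWeight φ ν (p β) pn
  let v := bregmanWeightV φ ν (p β) pn
  let m := weightedMean μ p β w
  (weightedCov μ p β w)⁻¹ * (weightedCov μ p β v - (1 + 1 / ν) • Matrix.vecMulVec m m)
    * (weightedCov μ p β w)⁻¹

/-- Number of data points `T_d` when the budget `T = T_d + T_n` is split with noise-data ratio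
`ν = T_n / T_d`. -/
def dataSize (ν T : ℝ) : ℝ := T / (ν + 1)

/-- Proportion `T_n / T` of noise points when the noise-data ratio is `ν = T_n / T_d`. -/
def noiseProportion (ν : ℝ) : ℝ := ν / (ν + 1)

/-- (Asymptotic) mean-squared error `tr(Σ) / T_d` of the estimator obtained from the Bregman
classification loss `φ`. -/
def bregmanMSE (μ : Measure X) (p : EuclideanSpace ℝ (Fin d) → X → ℝ)
    (β : EuclideanSpace ℝ (Fin d)) (φ : ℝ → ℝ) (pn : X → ℝ) (ν T : ℝ) : ℝ :=
  1 / dataSize ν T * (asympVar μ p β φ pn ν).trace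

/-- The Jensen-Shannon generator, which gives the logistic classification loss. -/
def logisticPhi (x : ℝ) : ℝ := x * Real.log x - (1 + x) * Real.log ((1 + x) / 2)

/-- (Asymptotic) mean-squared error of the original NCE estimator (logistic loss), for true
parameter `β`, noise density `pn`, noise-data ratio `ν` and budget `T`. -/
def nceMSE (μ : Measure X) (p : EuclideanSpace ℝ (Fin d) → X → ℝ)
    (β : EuclideanSpace ℝ (Fin d)) (pn : X → ℝ) (ν T : ℝ) : ℝ :=
  bregmanMSE μ p β logisticPhi pn ν T

/-- (Asymptotic) mean-squared error `tr(J⁻¹) / T_d` of maximum-likelihood estimation from `Td` data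
points in a normalized model with Fisher information `J`. -/
def mleMSE (μ : Measure X) (p : EuclideanSpace ℝ (Fin d) → X → ℝ)
    (β : EuclideanSpace ℝ (Fin d)) (Td : ℝ) : ℝ :=
  1 / Td * ((scoreCov μ p β)⁻¹).trace

/-- The matrix `I⁻¹ - I⁻¹ m mᵀ I⁻¹`. -/
def reducedVar (μ : Measure X) (p : EuclideanSpace ℝ (Fin d) → X → ℝ)
    (β : EuclideanSpace ℝ (Fin d)) : Matrix (Fin d) (Fin d) ℝ :=
  (scoreCov μ p β)⁻¹ -
    (scoreCov μ p β)⁻¹ * Matrix.vecMulVec (scoreMean μ p β) (scoreMean μ p β)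
      * (scoreCov μ p β)⁻¹

/-- The model is normalized on the parameter set `Θ`. -/
def IsNormalizedOn (μ : Measure X) (p : EuclideanSpace ℝ (Fin d) → X → ℝ)
    (Θ : Set (EuclideanSpace ℝ (Fin d))) : Prop :=
  ∀ β ∈ Θ, ∫ x, p β x ∂μ = 1

/-- Near `β`, the increments `p_b - p_β` are dominated by `‖b - β‖` times a fixed integrable
function (the usual condition for differentiating `∫ p_b dμ` under the integral sign). -/
def LocallyDominatedAt (μ : Measure X) (p : EuclideanSpace ℝ (Fin d) → X → ℝ)
    (β : EuclideanSpace ℝ (Fin d)) : Prop :=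
  ∃ r > 0, ∃ g : X → ℝ, Integrable g μ ∧
    ∀ᵐ x ∂μ, ∀ b ∈ Metric.ball β r, |p b x - p β x| ≤ g x * ‖b - β‖

end NCE

end

open MeasureTheory Filter Topology Set
open scoped Matrix

noncomputable section

namespace NCE

/-! ### Weights of the logistic loss, and the score. -/

variable {X : Type*} {d : ℕ}

/-! For the logistic loss `φ''(t) = 1 / (t(1+t))`, so `w = 1/(1+r)` is the noise posterior, and
hence `v = w²/w = w`. The sandwich `I_w⁻¹ I_v I_w⁻¹` then collapses to `I_w⁻¹`
(`asympVar_of_ae_eq`).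

If `p_n = p_d`, this weight is the constant `ν/(ν+1)` and factors out of all moments, leaving
`(ν+1)²/(νT)` times the trace of `reducedVar` (`nceMSE_of_noise_eq_data`). That trace is
nonnegative, since `reducedVar` is `I⁻¹ Cov(s) I⁻¹`, so it remains to minimize `(ν+1)²/ν`. For a
normalized model, differentiating `∫ p_β = 1` gives `m = 0` (`scoreMean_eq_zero`), and the ratio to
maximum likelihood can be read off. -/

theorem deriv_logisticPhi {t : ℝ} (ht : 0 < t) :
    deriv logisticPhi t = Real.log t - Real.log ((1 + t) / 2) := by
  have h1 : HasDerivAt (fun x : ℝ => x * Real.log x) (Real.log t + 1) t :=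
    Real.hasDerivAt_mul_log ht.ne'
  have h2 : HasDerivAt (fun x : ℝ => 1 + x) 1 t := (hasDerivAt_id t).const_add 1
  have h3 := h2.mul ((h2.div_const 2).log (by positivity))
  have h4 := h1.sub h3
  refine (h4.congr_deriv ?_).deriv
  field_simp
  ring

theorem deriv_deriv_logisticPhi {t : ℝ} (ht : 0 < t) :
    deriv (deriv logisticPhi) t = 1 / (t * (1 + t)) := by
  have hev : deriv logisticPhi =ᶠ[𝓝 t] fun x => Real.log x - Real.log ((1 + x) / 2) := by
    filter_upwards [lt_mem_nhds ht] with x hx using deriv_logisticPhi hx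
  rw [hev.deriv_eq]
  have h2 : HasDerivAt (fun x : ℝ => 1 + x) 1 t := (hasDerivAt_id t).const_add 1
  have h4 := (Real.hasDerivAt_log ht.ne').sub ((h2.div_const 2).log (by positivity))
  refine (h4.congr_deriv ?_).deriv
  field_simp
  ring

/-- For the logistic loss, `w` is the posterior probability of noise. -/
theorem bregmanWeight_logisticPhi {ν : ℝ} (hν : 0 < ν) {pd pn : X → ℝ} {x : X}
    (hd : 0 < pd x) (hn : 0 ≤ pn x) :
    bregmanWeight logisticPhi ν pd pn x = noisePosterior ν pd pn x := by
  unfold bregmanWeight noisePosterior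
  -- Where `p_n = 0`, division by zero makes `r = 0`, so both sides vanish.
  rcases hn.eq_or_lt with h | h
  · simp [← h]
  · rw [deriv_deriv_logisticPhi (by positivity)]
    field_simp
    ring

theorem bregmanWeightV_logisticPhi {ν : ℝ} (hν : 0 < ν) {pd pn : X → ℝ} {x : X}
    (hd : 0 < pd x) (hn : 0 ≤ pn x) :
    bregmanWeightV logisticPhi ν pd pn x = noisePosterior ν pd pn x := by
  unfold bregmanWeightV
  rw [bregmanWeight_logisticPhi hν hd hn]
  by_cases h : noisePosterior ν pd pn x = 0
  · simp [h]
  · field_simp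

/-- The density times the score is the gradient of the density, also where the density vanishes:
there it has a local minimum. -/
theorem mul_score_apply {p : EuclideanSpace ℝ (Fin d) → X → ℝ} {β : EuclideanSpace ℝ (Fin d)}
    {Θ : Set (EuclideanSpace ℝ (Fin d))} (hp : ∀ β ∈ Θ, ∀ x, 0 ≤ p β x)
    (hβ : Θ ∈ 𝓝 β) {x : X} (hx : DifferentiableAt ℝ (fun b => p b x) β) (i : Fin d) :
    p β x * score p β x i =
      fderiv ℝ (fun b => p b x) β (EuclideanSpace.single i 1) := by
  rcases (hp β (mem_of_mem_nhds hβ) x).eq_or_lt with h | h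
  · have hmin : IsLocalMin (fun b => p b x) β := by
      filter_upwards [hβ] with b hb
      rw [← h]
      exact hp b hb x
    rw [hmin.fderiv_eq_zero, ← h]
    simp
  · have hs : score p β x i =
        fderiv ℝ (fun b => Real.log (p b x)) β (EuclideanSpace.single i 1) := by
      rw [← InnerProductSpace.toDual_symm_apply, EuclideanSpace.inner_single_right]
      simp [score, gradient]
    rw [hs, fderiv.log hx h.ne']
    simp [h.ne']

/-! ### The data distribution. -/

variable [MeasurableSpace X]

theorem densityMeasure_absolutelyContinuous (μ : Measure X) (f : X → ℝ) :
    densityMeasure μ f ≪ μ :=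
  withDensity_absolutelyContinuous _ _

/-- The pointwise weight formulas need `p_d > 0`; this makes them available almost everywhere under
the data distribution. -/
theorem ae_densityMeasure_pos {μ : Measure X} {f : X → ℝ} (hf : Integrable f μ) :
    ∀ᵐ x ∂(densityMeasure μ f), 0 < f x := by
  unfold densityMeasure
  rw [ae_withDensity_iff' hf.aemeasurable.ennreal_ofReal]
  refine ae_of_all _ fun x hx => ?_
  by_contra h
  exact hx (ENNReal.ofReal_of_nonpos (not_lt.mp h))

theorem isProbabilityMeasure_densityMeasure {μ : Measure X} {f : X → ℝ} (hf : ∀ x, 0 ≤ f x)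
    (h1 : ∫ x, f x ∂μ = 1) : IsProbabilityMeasure (densityMeasure μ f) := by
  refine ⟨?_⟩
  unfold densityMeasure
  rw [withDensity_apply _ MeasurableSet.univ, setLIntegral_univ, ← ofReal_integral_eq_lintegral_ofReal (.of_integral_ne_zero (by simp [h1]))
    (ae_of_all _ hf), h1, ENNReal.ofReal_one]

theorem integral_densityMeasure {μ : Measure X} {f : X → ℝ} (hf : Integrable f μ)
    (h0 : ∀ x, 0 ≤ f x) (g : X → ℝ) :
    ∫ x, g x ∂(densityMeasure μ f) = ∫ x, f x * g x ∂μ := by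
  unfold densityMeasure
  rw [integral_withDensity_eq_integral_toReal_smul₀ hf.aemeasurable.ennreal_ofReal
    (ae_of_all _ fun _ => ENNReal.ofReal_lt_top)]
  simp [ENNReal.toReal_ofReal (h0 _)]

/-! ### Reweighted moments and the NCE error. -/

section Weights

variable {μ : Measure X} {p : EuclideanSpace ℝ (Fin d) → X → ℝ} {β : EuclideanSpace ℝ (Fin d)}

theorem weightedMean_congr {w u : X → ℝ} (h : w =ᵐ[densityMeasure μ (p β)] u) :
    weightedMean μ p β w = weightedMean μ p β u := by
  ext i
  refine integral_congr_ae ?_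
  filter_upwards [h] with x hx
  rw [hx]

theorem weightedCov_congr {w u : X → ℝ} (h : w =ᵐ[densityMeasure μ (p β)] u) :
    weightedCov μ p β w = weightedCov μ p β u := by
  ext i j
  refine integral_congr_ae ?_
  filter_upwards [h] with x hx
  rw [hx]

theorem weightedMean_const (c : ℝ) :
    weightedMean μ p β (fun _ => c) = c • scoreMean μ p β := by
  ext i
  exact integral_const_mul c _

theorem weightedCov_const (c : ℝ) :
    weightedCov μ p β (fun _ => c) = c • scoreCov μ p β := by
  ext i j
  exact integral_const_mul c _

/-- A singular matrix has inverse `0`, so the general error formula needs no invertibility of `I_w`.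
-/
theorem inv_mul_self_mul_inv (A : Matrix (Fin d) (Fin d) ℝ) : A⁻¹ * A * A⁻¹ = A⁻¹ := by
  by_cases h : IsUnit A.det
  · rw [Matrix.nonsing_inv_mul _ h, one_mul]
  · simp [Matrix.nonsing_inv_apply_not_isUnit _ h]

theorem asympVar_of_ae_eq {φ : ℝ → ℝ} {pn u : X → ℝ} {ν : ℝ}
    (hw : bregmanWeight φ ν (p β) pn =ᵐ[densityMeasure μ (p β)] u)
    (hv : bregmanWeightV φ ν (p β) pn =ᵐ[densityMeasure μ (p β)] u) :
    asympVar μ p β φ pn ν = (weightedCov μ p β u)⁻¹ - (1 + 1 / ν) •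
      ((weightedCov μ p β u)⁻¹ *
        Matrix.vecMulVec (weightedMean μ p β u) (weightedMean μ p β u) *
          (weightedCov μ p β u)⁻¹) := by
  unfold asympVar
  simp only [weightedCov_congr hw, weightedCov_congr hv, weightedMean_congr hw]
  rw [mul_sub, sub_mul, inv_mul_self_mul_inv, Matrix.mul_smul, Matrix.smul_mul]

theorem nceMSE_eq (hint : Integrable (p β) μ) {pn : X → ℝ}
    (hpn : ∀ᵐ x ∂(densityMeasure μ (p β)), 0 ≤ pn x) {ν : ℝ} (hν : 0 < ν) (T : ℝ) :
    nceMSE μ p β pn ν T =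
      (ν + 1) / T *
        ((weightedCov μ p β (noisePosterior ν (p β) pn))⁻¹ -
          ((ν + 1) / ν) •
            ((weightedCov μ p β (noisePosterior ν (p β) pn))⁻¹ *
              Matrix.vecMulVec
                (weightedMean μ p β (noisePosterior ν (p β) pn))
                (weightedMean μ p β (noisePosterior ν (p β) pn)) *
              (weightedCov μ p β (noisePosterior ν (p β) pn))⁻¹)).trace := by
  have hw : bregmanWeight logisticPhi ν (p β) pn =ᵐ[densityMeasure μ (p β)]
      noisePosterior ν (p β) pn := by
    filter_upwards [ae_densityMeasure_pos hint, hpn] with x h1 h2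
      using bregmanWeight_logisticPhi hν h1 h2
  have hv : bregmanWeightV logisticPhi ν (p β) pn =ᵐ[densityMeasure μ (p β)]
      noisePosterior ν (p β) pn := by
    filter_upwards [ae_densityMeasure_pos hint, hpn] with x h1 h2
      using bregmanWeightV_logisticPhi hν h1 h2
  unfold nceMSE bregmanMSE dataSize
  rw [asympVar_of_ae_eq hw hv, one_div_div, show 1 + 1 / ν = (ν + 1) / ν by field_simp]

theorem nceMSE_of_noise_eq_data (hint : Integrable (p β) μ) (hI : IsUnit (scoreCov μ p β).det)
    {pn : X → ℝ} (hpn : pn =ᵐ[μ] p β) {ν : ℝ} (hν : 0 < ν) (T : ℝ) :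
    nceMSE μ p β pn ν T = (ν + 1) ^ 2 / (ν * T) * (reducedVar μ p β).trace := by
  have hpn' : pn =ᵐ[densityMeasure μ (p β)] p β :=
    (densityMeasure_absolutelyContinuous μ _).ae_eq hpn
  have hpos := ae_densityMeasure_pos hint
  have hc : noisePosterior ν (p β) pn =ᵐ[densityMeasure μ (p β)] fun _ => ν / (ν + 1) := by
    filter_upwards [hpn', hpos] with x h1 h2
    unfold noisePosterior
    rw [h1]
    field_simp
    ring
  have h0 : ν / (ν + 1) ≠ 0 := by positivity
  have hinv : ((ν / (ν + 1)) • scoreCov μ p β)⁻¹ = ((ν + 1) / ν) • (scoreCov μ p β)⁻¹ := by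
    refine Matrix.inv_eq_left_inv ?_
    rw [Matrix.smul_mul, Matrix.mul_smul, Matrix.nonsing_inv_mul _ hI, smul_smul,
      show (ν + 1) / ν * (ν / (ν + 1)) = 1 by field_simp, one_smul]
  rw [nceMSE_eq hint (by filter_upwards [hpn', hpos] with x h1 h2; rw [h1]; exact h2.le) hν,
    weightedCov_congr hc, weightedMean_congr hc, weightedCov_const, weightedMean_const, hinv]
  unfold reducedVar
  simp only [Matrix.smul_vecMulVec, Matrix.vecMulVec_smul, Matrix.smul_mul, Matrix.mul_smul,
    smul_smul, Matrix.trace_sub, Matrix.trace_smul, smul_eq_mul]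
  field_simp

end Weights

/-- The second moment matrix of a square-integrable random vector is positive semidefinite. -/
theorem posSemidef_secondMoment {P : Measure X} {f : Fin d → X → ℝ} (hf : ∀ i, MemLp (f i) 2 P) :
    (Matrix.of fun i j => ∫ x, f i x * f j x ∂P).PosSemidef := by
  refine .of_dotProduct_mulVec_nonneg ?_ fun y => ?_
  · ext i j
    simp [Matrix.conjTranspose_apply, mul_comm]
  · have hint : ∀ i j, Integrable (fun x => y i * (f i x * f j x * y j)) P := fun i j =>
      (((hf i).integrable_mul (hf j)).mul_const (y j)).const_mul (y i)
    -- The quadratic form at `y` is the second moment of the scalar `∑ i, y i * f i`.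
    have : star y ⬝ᵥ (Matrix.of fun i j => ∫ x, f i x * f j x ∂P) *ᵥ y
        = ∫ x, (∑ i, y i * f i x) ^ 2 ∂P := by
      simp only [dotProduct, Matrix.mulVec, Matrix.of_apply, Finset.mul_sum, sq, Finset.sum_mul,
        Pi.star_apply, star_trivial]
      rw [Finset.sum_comm, integral_finsetSum _ fun j _ => ?_]
      · refine Finset.sum_congr rfl fun j _ => ?_
        rw [integral_finsetSum _ fun i _ => ?_]
        · refine Finset.sum_congr rfl fun i _ => ?_
          rw [← integral_mul_const, ← integral_const_mul]
          congr 1; ext x; ring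
        · exact (hint i j).congr (ae_of_all _ fun x => by ring)
      · refine integrable_finsetSum _ fun i _ => ?_
        exact (hint i j).congr (ae_of_all _ fun x => by ring)
    rw [this]
    positivity

/-! ### Covariance and mean of the score. -/

section Covariance

variable {μ : Measure X} {p : EuclideanSpace ℝ (Fin d) → X → ℝ} {β : EuclideanSpace ℝ (Fin d)}

theorem posDef_scoreCov (hL2 : MemLp (score p β) 2 (densityMeasure μ (p β)))
    (hI : IsUnit (scoreCov μ p β).det) : (scoreCov μ p β).PosDef :=
  (posSemidef_secondMoment fun i => hL2.eval_piLp i).posDef_iff_isUnit.mpr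
    ((Matrix.isUnit_iff_isUnit_det _).mpr hI)

/-- This is the second moment matrix of the centred score; total mass one turns the cross terms into
`-m mᵀ`. -/
theorem posSemidef_scoreCov_sub [IsProbabilityMeasure (densityMeasure μ (p β))]
    (hL2 : MemLp (score p β) 2 (densityMeasure μ (p β))) :
    (scoreCov μ p β -
      Matrix.vecMulVec (scoreMean μ p β) (scoreMean μ p β)).PosSemidef := by
  have h2 : ∀ i, MemLp (fun x => score p β x i) 2 (densityMeasure μ (p β)) :=
    fun i => hL2.eval_piLp i
  have h1 : ∀ i, Integrable (fun x => score p β x i) (densityMeasure μ (p β)) :=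
    fun i => (h2 i).integrable one_le_two
  convert posSemidef_secondMoment (d := d)
    (f := fun i x => score p β x i - scoreMean μ p β i) (P := densityMeasure μ (p β))
    fun i => (h2 i).sub (memLp_const _) using 1
  ext i j
  have hij := (h2 i).integrable_mul (h2 j)
  have hm : ∀ k, ∫ x, score p β x k ∂(densityMeasure μ (p β)) = scoreMean μ p β k :=
    fun _ => rfl
  have e : (fun x => (score p β x i - scoreMean μ p β i) * (score p β x j - scoreMean μ p β j))
      = fun x => score p β x i * score p β x j - scoreMean μ p β i * score p β x j
        - scoreMean μ p β j * score p β x i + scoreMean μ p β i * scoreMean μ p β j := by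
    ext x; ring
  simp only [Matrix.of_apply, Matrix.sub_apply, Matrix.vecMulVec_apply, scoreCov]
  rw [e, integral_add, integral_sub, integral_sub, integral_const_mul, integral_const_mul, hm, hm]
  · simp; ring
  · exact hij
  · exact (h1 j).const_mul _
  · exact hij.sub ((h1 j).const_mul _)
  · exact (h1 i).const_mul _
  · exact (hij.sub ((h1 j).const_mul _)).sub ((h1 i).const_mul _)
  · exact integrable_const _

theorem trace_reducedVar_nonneg [IsProbabilityMeasure (densityMeasure μ (p β))]
    (hL2 : MemLp (score p β) 2 (densityMeasure μ (p β)))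
    (hI : IsUnit (scoreCov μ p β).det) : 0 ≤ (reducedVar μ p β).trace := by
  have h := (posSemidef_scoreCov_sub hL2).mul_mul_conjTranspose_same (scoreCov μ p β)⁻¹
  rw [(posDef_scoreCov hL2 hI).inv.isHermitian.eq, mul_sub, sub_mul,
    inv_mul_self_mul_inv] at h
  exact h.trace_nonneg

/-- In a normalized model the score has mean zero. -/
theorem scoreMean_eq_zero {Θ : Set (EuclideanSpace ℝ (Fin d))}
    (hp : ∀ β ∈ Θ, ∀ x, 0 ≤ p β x) (hβ : Θ ∈ 𝓝 β)
    (hdiff : ∀ᵐ x ∂μ, DifferentiableAt ℝ (fun b => p b x) β)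
    (hnorm : IsNormalizedOn μ p Θ) (hdom : LocallyDominatedAt μ p β) :
    scoreMean μ p β = 0 := by
  -- A nonzero integral forces integrability, the default value being `0`.
  have hint : ∀ b ∈ Θ, Integrable (p b) μ := fun b hb =>
    .of_integral_ne_zero (by simp [hnorm b hb])
  have hβΘ := mem_of_mem_nhds hβ
  obtain ⟨r, hr, g, hg, hgb⟩ := hdom
  ext i
  set e : EuclideanSpace ℝ (Fin d) := EuclideanSpace.single i 1 with he
  have hnear : ∀ᶠ n : ℕ in atTop, β + ((n : ℝ) + 1)⁻¹ • e ∈ Θ ∩ Metric.ball β r := by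
    have : Tendsto (fun n : ℕ => β + ((n : ℝ) + 1)⁻¹ • e) atTop (𝓝 (β + (0 : ℝ) • e)) := by
      refine tendsto_const_nhds.add (Tendsto.smul_const ?_ e)
      simpa using tendsto_one_div_add_atTop_nhds_zero_nat (𝕜 := ℝ)
    rw [zero_smul, add_zero] at this
    exact this (inter_mem hβ (Metric.ball_mem_nhds β hr))
  -- Difference quotients along `e` with step `1/(n+1)` are bounded by `g`, because `‖e‖ = 1`;
  -- dominated convergence applies.
  have hlim : Tendsto
      (fun n : ℕ => ∫ x, ((n : ℝ) + 1) • (p (β + ((n : ℝ) + 1)⁻¹ • e) x - p β x) ∂μ) atTop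
      (𝓝 (∫ x, fderiv ℝ (fun b => p b x) β e ∂μ)) := by
    refine tendsto_integral_filter_of_dominated_convergence g ?_ ?_ hg ?_
    · filter_upwards [hnear] with n hn
      exact (((hint _ hn.1).sub (hint _ hβΘ)).smul ((n : ℝ) + 1)).aestronglyMeasurable
    · filter_upwards [hnear] with n hn
      filter_upwards [hgb] with x hx
      have h := hx _ hn.2
      have hn0 : (0 : ℝ) < (n : ℝ) + 1 := by positivity
      have hnorm_e : ‖e‖ = 1 := by simp [he]
      rw [add_sub_cancel_left, norm_smul, hnorm_e, Real.norm_of_nonneg (by positivity)] at h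
      rw [norm_smul, Real.norm_of_nonneg hn0.le, Real.norm_eq_abs]
      calc ((n : ℝ) + 1) * |p (β + ((n : ℝ) + 1)⁻¹ • e) x - p β x|
          ≤ ((n : ℝ) + 1) * (g x * (((n : ℝ) + 1)⁻¹ * 1)) := by gcongr
        _ = g x := by field_simp
    · filter_upwards [hdiff] with x hx
      refine hx.hasFDerivAt.lim e ?_
      refine tendsto_norm_atTop_atTop.comp ?_
      exact tendsto_atTop_add_const_right _ _ tendsto_natCast_atTop_atTop
  -- Both densities eventually have integral one, so the quotients integrate to zero.
  have hzero : Tendsto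
      (fun n : ℕ => ∫ x, ((n : ℝ) + 1) • (p (β + ((n : ℝ) + 1)⁻¹ • e) x - p β x) ∂μ) atTop
      (𝓝 0) := by
    refine tendsto_const_nhds.congr' ?_
    filter_upwards [hnear] with n hn
    rw [integral_smul, integral_sub (hint _ hn.1) (hint _ hβΘ), hnorm _ hn.1, hnorm _ hβΘ,
      sub_self, smul_zero]
  calc scoreMean μ p β i = ∫ x, p β x * score p β x i ∂μ :=
        integral_densityMeasure (hint _ hβΘ) (hp _ hβΘ) _
    _ = ∫ x, fderiv ℝ (fun b => p b x) β e ∂μ := by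
        refine integral_congr_ae ?_
        filter_upwards [hdiff] with x hx using mul_score_apply hp hβ hx i
    _ = 0 := tendsto_nhds_unique hlim hzero

theorem reducedVar_of_scoreMean_eq_zero (h : scoreMean μ p β = 0) :
    reducedVar μ p β = (scoreCov μ p β)⁻¹ := by
  simp [reducedVar, h]

end Covariance

/-- The reason is `(ν+1)² - 4ν = (ν-1)²`; the bound 4 is the value at `ν = 1`. -/
theorem four_lt_sq_div {ν : ℝ} (hν : 0 < ν) (h1 : ν ≠ 1) : 4 < (ν + 1) ^ 2 / ν := by
  rw [lt_div_iff₀ hν]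
  nlinarith [sq_pos_of_ne_zero (sub_ne_zero.mpr h1)]

end NCE

end

theorem mainTheorem5 {X : Type*} [MeasurableSpace X] (μ : Measure X) {d : ℕ} (hd : 1 ≤ d)
    -- a nonnegative parametric model, possibly unnormalized, on a neighbourhood of the
    -- true parameter
    (Θ : Set (EuclideanSpace ℝ (Fin d))) (p : EuclideanSpace ℝ (Fin d) → X → ℝ)
    (hp : ∀ β ∈ Θ, ∀ x, 0 ≤ p β x)
    (βs : EuclideanSpace ℝ (Fin d)) (hβs : Θ ∈ 𝓝 βs)
    -- the data density is the model at the true parameter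
    (hpd : ∫ x, p βs x ∂μ = 1)
    (hdiff : ∀ᵐ x ∂μ, DifferentiableAt ℝ (fun β => p β x) βs)
    -- the score is square-integrable and its covariance matrix is invertible
    (hL2 : MemLp (NCE.score p βs) 2 (NCE.densityMeasure μ (p βs)))
    (hI : IsUnit (NCE.scoreCov μ p βs).det) :
    -- the NCE error for an arbitrary noise density
    (∀ pn : X → ℝ, (∀ x, 0 ≤ pn x) → ∀ ν T : ℝ, 0 < ν → 0 < T →
      NCE.nceMSE μ p βs pn ν T =
        (ν + 1) / T *
          ((NCE.weightedCov μ p βs (NCE.noisePosterior ν (p βs) pn))⁻¹ -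
            ((ν + 1) / ν) •
              ((NCE.weightedCov μ p βs (NCE.noisePosterior ν (p βs) pn))⁻¹ *
                Matrix.vecMulVec
                  (NCE.weightedMean μ p βs (NCE.noisePosterior ν (p βs) pn))
                  (NCE.weightedMean μ p βs (NCE.noisePosterior ν (p βs) pn)) *
                (NCE.weightedCov μ p βs (NCE.noisePosterior ν (p βs) pn))⁻¹)).trace) ∧
    -- the noise density equals the data density
    (∀ pn : X → ℝ, pn =ᵐ[μ] p βs →
      (∀ ν T : ℝ, 0 < ν → 0 < T →
        NCE.nceMSE μ p βs pn ν T =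
          (ν + 1) ^ 2 / (ν * T) * (NCE.reducedVar μ p βs).trace) ∧
      (∀ T : ℝ, 0 < T →
        IsMinOn (fun ν => NCE.nceMSE μ p βs pn ν T) (Set.Ioi 0) 1 ∧
        ((NCE.reducedVar μ p βs).trace ≠ 0 → ∀ ν : ℝ, 0 < ν → ν ≠ 1 →
          NCE.nceMSE μ p βs pn 1 T < NCE.nceMSE μ p βs pn ν T)) ∧
      NCE.noiseProportion 1 = 1 / 2 ∧
      -- comparison with maximum likelihood for a normalized model
      (NCE.IsNormalizedOn μ p Θ → NCE.LocallyDominatedAt μ p βs →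
        ∀ ν T : ℝ, 0 < ν → 0 < T →
          NCE.nceMSE μ p βs pn ν T / NCE.mleMSE μ p βs (NCE.dataSize ν T) = 1 + 1 / ν)) := by
  have hβΘ := mem_of_mem_nhds hβs
  have hint : Integrable (p βs) μ := .of_integral_ne_zero (by simp [hpd])
  have := NCE.isProbabilityMeasure_densityMeasure (hp βs hβΘ) hpd
  have htr := NCE.trace_reducedVar_nonneg hL2 hI
  refine ⟨fun pn hpn ν T hν _ => NCE.nceMSE_eq hint (ae_of_all _ hpn) hν T, fun pn hpn => ?_⟩
  have key : ∀ ν T : ℝ, 0 < ν → NCE.nceMSE μ p βs pn ν T =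
      (ν + 1) ^ 2 / (ν * T) * (NCE.reducedVar μ p βs).trace :=
    fun ν T hν => NCE.nceMSE_of_noise_eq_data hint hI hpn hν T
  have hlt : ∀ T : ℝ, 0 < T → ∀ ν : ℝ, 0 < ν → ν ≠ 1 →
      (1 + 1 : ℝ) ^ 2 / (1 * T) < (ν + 1) ^ 2 / (ν * T) := by
    intro T hT ν hν h1
    rw [← div_div, ← div_div]
    have := NCE.four_lt_sq_div hν h1
    refine div_lt_div_of_pos_right ?_ hT
    norm_num
    exact this
  refine ⟨fun ν T hν _ => key ν T hν, fun T hT => ⟨fun ν hν => ?_, fun h0 ν hν h1 => ?_⟩,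
    by norm_num [NCE.noiseProportion], fun hnorm hdom ν T hν hT => ?_⟩
  · change NCE.nceMSE μ p βs pn 1 T ≤ NCE.nceMSE μ p βs pn ν T
    rw [key 1 T one_pos, key ν T hν]
    rcases eq_or_ne ν 1 with rfl | h1
    · exact le_rfl
    · exact mul_le_mul_of_nonneg_right (hlt T hT ν hν h1).le htr
  · rw [key 1 T one_pos, key ν T hν]
    exact mul_lt_mul_of_pos_right (hlt T hT ν hν h1) (htr.lt_of_ne' h0)
  -- With `d ≥ 1` the trace of the positive definite `I⁻¹` is positive and can be cancelled.
  · have : Nonempty (Fin d) := ⟨⟨0, hd⟩⟩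
    have hpos := (NCE.posDef_scoreCov hL2 hI).inv.trace_pos
    rw [key ν T hν, NCE.reducedVar_of_scoreMean_eq_zero
      (NCE.scoreMean_eq_zero hp hβs hdiff hnorm hdom)]
    unfold NCE.mleMSE NCE.dataSize
    field_simp
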